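/- Let $q$ be an indeterminate. Write $(a;q)_k=(1-a)(1-aq)\cdots(1-aq^{k-1})$ (with $(a;q)_0=1$), $[m]=1+q+\cdots+q^{m-1}$, and let $\Phi_n(q)$ be the $n$-th cyclotomic polynomial. For rational functions $A(q),B(q)\in\mathbb{Q}(q)$ and a polynomial $P(q)\in\mathbb{Q}[q]$, write $A(q)\equiv B(q)\pmod{P(q)}$ if $P(q)$ divides, in $\mathbb{Q}[q]$, the numerator of $A(q)-B(q)$ written in lowest terms. Then, for every positive odd integer $n$ and for both $M=(n-1)/2$ and $M=n-1$, $$\sum_{k=0}^{M}[4k+1]\frac{(q;q^2)_k^4}{(q^2;q^2)_k^4}\equiv q^{(1-n)/2}[n]+\frac{(n^2-1)(1-q)^2}{24}\,q^{(1-n)/2}[n]^3 \pmod{[n]\Phi_n(q)^3}.$$ -/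

import Mathlib

open Polynomial

/-- The `q`-shifted factorial `(a;q)_k = (1 - a)(1 - a q) ⋯ (1 - a q^(k-1))`. -/
def qShiftedFactorial {R : Type*} [CommRing R] (a q : R) (k : ℕ) : R :=
  ∏ i ∈ Finset.range k, (1 - a * q ^ i)

/-- The `q`-integer `[n] = 1 + q + ⋯ + q^(n-1)`. -/
def qInteger {R : Type*} [CommRing R] (q : R) (n : ℕ) : R :=
  ∑ i ∈ Finset.range n, q ^ i

/-- Congruence of rational functions modulo a polynomial `P`: in lowest terms, the numerator of
`A - B` is divisible by `P` (so that the denominator of `A - B` is coprime to `P`). -/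
def RatFuncCongr (P : ℚ[X]) (A B : RatFunc ℚ) : Prop :=
  P ∣ (A - B).num

/-- The truncated sum `∑_{k=0}^{M} [4k+1] (q;q²)_k⁴ / (q²;q²)_k⁴` in `ℚ(q)`. -/
noncomputable def truncatedSum (M : ℕ) : RatFunc ℚ :=
  let q : RatFunc ℚ := RatFunc.X
  ∑ k ∈ Finset.range (M + 1),
    qInteger q (4 * k + 1) * qShiftedFactorial q (q ^ 2) k ^ 4
      / qShiftedFactorial (q ^ 2) (q ^ 2) k ^ 4

/-- The rational function `q^((1-n)/2) [n] + (n² - 1)(1 - q)² / 24 * q^((1-n)/2) [n]³`, for odd `n`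
(so that the integer division by `2` in the exponent is exact). -/
noncomputable def congruenceRHS (n : ℕ) : RatFunc ℚ :=
  let q : RatFunc ℚ := RatFunc.X
  q ^ ((1 - (n : ℤ)) / 2) * qInteger q n
    + ((n : RatFunc ℚ) ^ 2 - 1) * (1 - q) ^ 2 / 24 * q ^ ((1 - (n : ℤ)) / 2) * qInteger q n ^ 3

/-! Let `n = 2N+1` and `y = q^n`. The very-well-poised `₆φ₅` series in base `q²` with `a = q`
carries parameters `b`, `c`, `1/y`; at `y = q^n` it terminates and equals a product
(`sum_wellPoised`). Choosing `b + c = 3 - 1/y` and `bc = y` gives the triple `(b, c, 1/y)` the same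
first and third elementary symmetric functions as `(1, 1, 1)`, while the second differs from `3` by
`w = -(1-y)³/y²`. The summand is thus the desired one perturbed by `w`, a multiple of `Φ_n³`.

The coefficient of `w` vanishes modulo `Φ_n`, because at a primitive `n`-th root of unity its terms
change sign under `k ↦ N-k` (`sum_qRatio_qLogDeriv_eq_zero`). Hence the short sum agrees with the
product modulo `Φ_n⁴`. Each factor of the product is `1 + O((1-y)²)`, and `∑ ζ^(2i+2)/(1-ζ^(2i+2))²
= -(n²-1)/24` over `i < N` (`sum_even_div_one_sub_sq`) produces the cubic term.

The terms with `N < k < n` contain `(1-q^n)⁴`, which settles the long sum modulo `Φ_n⁴`. The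
remaining factors `Φ_d` of `[n]` are needed only once: at a primitive `d`-th root of unity both sums
split into blocks that vanish by the same antisymmetry. -/

/-! ### The terminating very-well-poised summation. -/

section FieldIdentities

variable {K : Type*} [Field K]

/-- The part of the very-well-poised summand that does not depend on the terminating parameter. -/
def wellPoisedFactor (q s p : K) (k : ℕ) : K :=
  ∏ i ∈ Finset.range k, (1 - q ^ (2 * i + 1)) * (1 - s * q ^ (2 * i + 1) + p * q ^ (4 * i + 2)) /
    ((1 - q ^ (2 * i + 2)) * (p - s * q ^ (2 * i + 2) + q ^ (4 * i + 4)))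

/-- The part of the very-well-poised summand that depends on the terminating parameter `y`. -/
def terminatingFactor (q y : K) (k : ℕ) : K :=
  ∏ i ∈ Finset.range k, (y - q ^ (2 * i + 1)) / (1 - y * q ^ (2 * i + 2))

/-- Since `y q² - q^(2i+1) = q² (y - q^(2i-1))`, the shifted product overlaps the original one
except at its ends. -/
theorem terminatingFactor_shift (q y : K) (hq : q ≠ 0)
    (hy : ∀ i : ℕ, 1 - y * q ^ (2 * i + 2) ≠ 0) (k : ℕ) :
    terminatingFactor q (y * q ^ 2) (k + 1) =
      q ^ (2 * k + 2) * (y - 1 / q) * (1 - y * q ^ 2) * terminatingFactor q y k /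
        ((1 - y * q ^ (2 * k + 2)) * (1 - y * q ^ (2 * k + 4))) := by
  have e (i : ℕ) : y * q ^ 2 * q ^ (2 * i + 2) = y * q ^ (2 * i + 4) := by ring
  induction k with
  | zero =>
    have h0 := hy 0
    have h1 := hy 1
    simp only [terminatingFactor, Finset.prod_range_succ, Finset.prod_range_zero, e]
    simp only [mul_zero, mul_one, zero_add, one_mul, Nat.reduceAdd, pow_one] at *
    generalize 1 - y * q ^ 4 = d at *
    generalize 1 - y * q ^ 2 = d' at *
    field_simp
  | succ k ih =>
    rw [terminatingFactor, Finset.prod_range_succ, ← terminatingFactor, ih, terminatingFactor,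
      terminatingFactor, Finset.prod_range_succ, e]
    have h1 := hy k
    have h2 := hy (k + 1)
    have h3 := hy (k + 2)
    rw [show 2 * (k + 2) + 2 = 2 * (k + 1) + 4 by ring] at h3
    rw [show 2 * (k + 1) + 2 = 2 * k + 4 by ring] at *
    generalize ∏ i ∈ Finset.range k, (y - q ^ (2 * i + 1)) / (1 - y * q ^ (2 * i + 2)) = t
    generalize 1 - y * q ^ 2 = d
    generalize 1 - y * q ^ (2 * k + 2) = d₁ at *
    generalize 1 - y * q ^ (2 * k + 4) = d₂ at *
    generalize 1 - y * q ^ (2 * (k + 1) + 4) = d₃ at *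
    field_simp
    ring

/-- A contiguous relation between the sums at `y q²` and at `y`. The boundary term contains
`terminatingFactor q y m`, so it disappears once the series terminates, leaving a recursion in `N`.
-/
theorem sum_wellPoised_telescope (q s p y : K) (hq : q ≠ 0)
    (hq1 : ∀ i : ℕ, 1 - q ^ (2 * i + 2) ≠ 0)
    (hy : ∀ i : ℕ, 1 - y * q ^ (2 * i + 2) ≠ 0) (m : ℕ)
    (hβ : ∀ i < m, p - s * q ^ (2 * i + 2) + q ^ (4 * i + 4) ≠ 0) :
    ∑ k ∈ Finset.range (m + 1), (1 - q ^ (4 * k + 1)) * wellPoisedFactor q s p k *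
        ((p - s * (y * q) + (y * q) ^ 2) * terminatingFactor q (y * q ^ 2) k -
          (1 - y * q ^ 2) * (p - y) * terminatingFactor q y k) =
      y * (1 - y * q ^ 2) * wellPoisedFactor q s p m * (1 - q ^ (2 * m + 1)) *
        (1 - s * q ^ (2 * m + 1) + p * q ^ (4 * m + 2)) * terminatingFactor q y m /
          (1 - y * q ^ (2 * m + 2)) := by
  induction m with
  | zero =>
    have h0 := hy 0
    simp only [wellPoisedFactor, terminatingFactor, Finset.sum_range_succ, Finset.sum_range_zero,
      Finset.prod_range_zero, mul_zero, zero_add, pow_one, mul_one] at *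
    rw [eq_div_iff h0]
    ring
  | succ m ih =>
    rw [Finset.sum_range_succ, ih (fun i hi => hβ i (by omega)), terminatingFactor_shift q y hq hy]
    have h1 := hq1 m
    have h2 := hy m
    have h3 : 1 - y * q ^ (2 * m + 4) ≠ 0 := hy (m + 1)
    have h4 := hβ m (by omega)
    rw [wellPoisedFactor, wellPoisedFactor, terminatingFactor, terminatingFactor,
      Finset.prod_range_succ, Finset.prod_range_succ, ← wellPoisedFactor, ← terminatingFactor]
    generalize wellPoisedFactor q s p m = a
    generalize terminatingFactor q y m = t
    rw [show 2 * (m + 1) + 2 = 2 * m + 4 by ring, show 2 * (m + 1) + 1 = 2 * m + 3 by ring,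
      show 4 * (m + 1) + 1 = 4 * m + 5 by ring, show 4 * (m + 1) + 2 = 4 * m + 6 by ring]
    have e : q ^ (4 * m) = (q ^ (2 * m)) ^ 2 := by rw [← pow_mul]; ring_nf
    rw [pow_add _ (4 * m), e] at h4
    rw [pow_add _ (2 * m)] at h1 h2 h3 h4
    rw [pow_add _ (2 * m) 1, pow_add _ (2 * m) 2, pow_add _ (2 * m) 3, pow_add _ (2 * m) 4,
      pow_add _ (4 * m) 4, pow_add _ (4 * m) 2, pow_add _ (4 * m) 6, pow_add _ (4 * m) 5, e]
    generalize q ^ (2 * m) = z at *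
    obtain ⟨d₁, e₁⟩ : ∃ d, d = 1 - z * q ^ 2 := ⟨_, rfl⟩
    obtain ⟨d₂, e₂⟩ : ∃ d, d = 1 - y * (z * q ^ 2) := ⟨_, rfl⟩
    obtain ⟨d₃, e₃⟩ : ∃ d, d = 1 - y * (z * q ^ 4) := ⟨_, rfl⟩
    obtain ⟨d₄, e₄⟩ : ∃ d, d = p - s * (z * q ^ 2) + z ^ 2 * q ^ 4 := ⟨_, rfl⟩
    rw [← e₁] at h1
    rw [← e₂] at h2
    rw [← e₃] at h3
    rw [← e₄] at h4
    rw [← e₁, ← e₂, ← e₃, ← e₄]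
    field_simp
    subst e₁ e₂ e₃ e₄
    ring

/-- Here `s = b + c` and `p = bc`; working with these avoids needing `b` and `c` themselves in the
field. -/
theorem sum_wellPoised (q s p : K) (hq1 : ∀ m : ℕ, 0 < m → 1 - q ^ m ≠ 0) (hq : q ≠ 0) (N : ℕ)
    (hβ : ∀ i < N, p - s * q ^ (2 * i + 2) + q ^ (4 * i + 4) ≠ 0) :
    ∑ k ∈ Finset.range (N + 1), (1 - q ^ (4 * k + 1)) * wellPoisedFactor q s p k *
        terminatingFactor q (q ^ (2 * N + 1)) k =
      (1 - q) * ∏ i ∈ Finset.range N, (1 - q ^ (2 * i + 3)) * (p - q ^ (2 * i + 1)) /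
        (p - s * q ^ (2 * i + 2) + q ^ (4 * i + 4)) := by
  induction N with
  | zero => simp [wellPoisedFactor, terminatingFactor]
  | succ N ih =>
    have ih := ih (fun i hi => hβ i (by omega))
    have hy (i : ℕ) : 1 - q ^ (2 * N + 1) * q ^ (2 * i + 2) ≠ 0 := by
      rw [← pow_add]; exact hq1 _ (by omega)
    have key := sum_wellPoised_telescope q s p (q ^ (2 * N + 1)) hq
      (fun i => hq1 _ (by omega)) hy (N + 1) hβ
    -- The factor `i = N` is `q^(2N+1) - q^(2N+1)`; this kills both the boundary term and the last
    -- term of the sum at `y`.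
    have hz : terminatingFactor q (q ^ (2 * N + 1)) (N + 1) = 0 :=
      Finset.prod_eq_zero (Finset.mem_range.2 (Nat.lt_succ_self N)) (by simp)
    rw [hz, mul_zero, zero_div] at key
    rw [Finset.sum_congr rfl fun k _ => mul_sub _ _ _, Finset.sum_sub_distrib,
      Finset.sum_range_succ (fun k => _ * ((1 - q ^ (2 * N + 1) * q ^ 2) * _ * _)), hz] at key
    rw [Finset.prod_range_succ, ← mul_assoc, ← ih, mul_div_assoc', eq_div_iff (hβ N (by omega))]
    have e1 : q ^ (2 * N + 1) * q = q ^ (2 * N + 2) := by ring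
    have e2 : q ^ (2 * N + 1) * q ^ 2 = q ^ (2 * (N + 1) + 1) := by ring
    have e3 : (q ^ (2 * N + 2)) ^ 2 = q ^ (4 * N + 4) := by rw [← pow_mul]; ring_nf
    rw [e1, e2, e3] at key
    rw [Finset.sum_mul, Finset.sum_mul]
    rw [← sub_eq_zero, ← key]
    simp only [mul_zero, add_zero]
    congr 1
    · exact Finset.sum_congr rfl fun k _ => by ring
    · exact Finset.sum_congr rfl fun k _ => by ring

end FieldIdentities

/-! ### Values of rational functions at a complex point, and divisibility by cyclotomic powers. -/

section Specialization

/-- The rational function `f` is regular at `ζ` and takes the value `c` there. -/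
def SpecializesTo (ζ : ℂ) (f : RatFunc ℚ) (c : ℂ) : Prop :=
  ∃ a d : ℚ[X], aeval ζ d ≠ 0 ∧ f * algebraMap ℚ[X] (RatFunc ℚ) d = algebraMap ℚ[X] (RatFunc ℚ) a ∧
    c * aeval ζ d = aeval ζ a

namespace SpecializesTo

variable {ζ : ℂ} {f g : RatFunc ℚ} {b c : ℂ}

theorem of_eq (h : SpecializesTo ζ f c) (hc : c = b) : SpecializesTo ζ f b := hc ▸ h

theorem polynomial (ζ : ℂ) (a : ℚ[X]) :
    SpecializesTo ζ (algebraMap ℚ[X] (RatFunc ℚ) a) (aeval ζ a) :=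
  ⟨a, 1, by simp, by simp, by simp⟩

theorem X (ζ : ℂ) : SpecializesTo ζ RatFunc.X ζ := by
  simpa using polynomial ζ Polynomial.X

theorem one (ζ : ℂ) : SpecializesTo ζ 1 1 := by simpa using polynomial ζ 1

theorem zero (ζ : ℂ) : SpecializesTo ζ 0 0 := by simpa using polynomial ζ 0

theorem natCast (ζ : ℂ) (n : ℕ) : SpecializesTo ζ n n := by
  simpa using polynomial ζ (n : ℚ[X])

theorem add (hf : SpecializesTo ζ f b) (hg : SpecializesTo ζ g c) : SpecializesTo ζ (f + g) (b + c) := by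
  obtain ⟨a, d, hd, e, e'⟩ := hf
  obtain ⟨a', d', hd', h, h'⟩ := hg
  refine ⟨a * d' + a' * d, d * d', by simp [hd, hd'], ?_, ?_⟩
  · simp only [map_mul, map_add, ← e, ← h]; ring
  · simp only [map_mul, map_add, ← e', ← h']; ring

theorem mul (hf : SpecializesTo ζ f b) (hg : SpecializesTo ζ g c) : SpecializesTo ζ (f * g) (b * c) := by
  obtain ⟨a, d, hd, e, e'⟩ := hf
  obtain ⟨a', d', hd', h, h'⟩ := hg
  refine ⟨a * a', d * d', by simp [hd, hd'], ?_, ?_⟩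
  · simp only [map_mul, ← e, ← h]; ring
  · simp only [map_mul, ← e', ← h']; ring

theorem neg (hf : SpecializesTo ζ f b) : SpecializesTo ζ (-f) (-b) := by
  obtain ⟨a, d, hd, e, e'⟩ := hf
  exact ⟨-a, d, hd, by simp [← e], by simp [← e']⟩

theorem sub (hf : SpecializesTo ζ f b) (hg : SpecializesTo ζ g c) : SpecializesTo ζ (f - g) (b - c) := by
  simpa only [sub_eq_add_neg] using hf.add hg.neg

theorem inv (hf : SpecializesTo ζ f b) (hb : b ≠ 0) : SpecializesTo ζ f⁻¹ b⁻¹ := by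
  obtain ⟨a, d, hd, e, e'⟩ := hf
  have ha : aeval ζ a ≠ 0 := e' ▸ mul_ne_zero hb hd
  have ha' : algebraMap ℚ[X] (RatFunc ℚ) a ≠ 0 := fun h => by
    rw [map_eq_zero_iff _ (RatFunc.algebraMap_injective ℚ)] at h
    simp [h] at ha
  have hf : f ≠ 0 := fun h => ha' (by rw [← e, h, zero_mul])
  refine ⟨d, a, ha, ?_, ?_⟩
  · rw [← e, inv_mul_cancel_left₀ hf]
  · rw [← e', inv_mul_cancel_left₀ hb]

theorem div (hf : SpecializesTo ζ f b) (hg : SpecializesTo ζ g c) (hc : c ≠ 0) :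
    SpecializesTo ζ (f / g) (b / c) := by
  simpa only [div_eq_mul_inv] using hf.mul (hg.inv hc)

theorem pow (hf : SpecializesTo ζ f b) (k : ℕ) : SpecializesTo ζ (f ^ k) (b ^ k) := by
  induction k with
  | zero => simpa using one ζ
  | succ k ih => simpa only [pow_succ] using ih.mul hf

theorem sum {s : Finset ℕ} {F : ℕ → RatFunc ℚ} {G : ℕ → ℂ}
    (h : ∀ i ∈ s, SpecializesTo ζ (F i) (G i)) : SpecializesTo ζ (∑ i ∈ s, F i) (∑ i ∈ s, G i) := by
  induction s using Finset.cons_induction with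
  | empty => simpa using zero ζ
  | cons a s ha ih =>
    rw [Finset.sum_cons, Finset.sum_cons]
    exact (h a (by simp)).add (ih fun i hi => h i (by simp [hi]))

theorem prod {s : Finset ℕ} {F : ℕ → RatFunc ℚ} {G : ℕ → ℂ}
    (h : ∀ i ∈ s, SpecializesTo ζ (F i) (G i)) : SpecializesTo ζ (∏ i ∈ s, F i) (∏ i ∈ s, G i) := by
  induction s using Finset.cons_induction with
  | empty => simpa using one ζ
  | cons a s ha ih =>
    rw [Finset.prod_cons, Finset.prod_cons]
    exact (h a (by simp)).mul (ih fun i hi => h i (by simp [hi]))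

theorem ne_zero (hf : SpecializesTo ζ f b) (hb : b ≠ 0) : f ≠ 0 := by
  obtain ⟨a, d, hd, e, e'⟩ := hf
  rintro rfl
  rw [zero_mul, eq_comm, map_eq_zero_iff _ (RatFunc.algebraMap_injective ℚ)] at e
  rw [e, map_zero, mul_eq_zero] at e'
  exact e'.elim hb hd

/-- `1 - q ^ m` specializes to `1 - ζ ^ m`. -/
theorem one_sub_X_pow (ζ : ℂ) (m : ℕ) : SpecializesTo ζ (1 - RatFunc.X ^ m) (1 - ζ ^ m) :=
  (one ζ).sub ((X ζ).pow m)

theorem qInteger (hf : SpecializesTo ζ f b) (m : ℕ) :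
    SpecializesTo ζ (qInteger f m) (_root_.qInteger b m) :=
  sum fun i _ => hf.pow i

end SpecializesTo

theorem cyclotomic_dvd_of_aeval_eq_zero {n : ℕ} (hn : 0 < n) {ζ : ℂ} (hζ : IsPrimitiveRoot ζ n)
    {a : ℚ[X]} (ha : aeval ζ a = 0) : cyclotomic n ℚ ∣ a := by
  rw [cyclotomic_eq_minpoly_rat hζ hn]
  exact minpoly.dvd ℚ ζ ha

/-- `Φ_n` is the minimal polynomial of `ζ`, so the zero of `g` contributes one more factor; a
denominator nonzero at `ζ` is coprime to `Φ_n` and can be cleared. -/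
theorem cyclotomic_pow_dvd_num {n : ℕ} (hn : 0 < n) {ζ : ℂ} (hζ : IsPrimitiveRoot ζ n) (m : ℕ)
    {b : ℚ[X]} (hb : cyclotomic n ℚ ^ m ∣ b) {f g : RatFunc ℚ} (hg : SpecializesTo ζ g 0)
    (hf : f = algebraMap ℚ[X] (RatFunc ℚ) b * g) : cyclotomic n ℚ ^ (m + 1) ∣ f.num := by
  obtain ⟨a, d, hd, e, e'⟩ := hg
  have ha : cyclotomic n ℚ ∣ a :=
    cyclotomic_dvd_of_aeval_eq_zero hn hζ (by rw [← e', zero_mul])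
  have hcop : IsCoprime (cyclotomic n ℚ ^ (m + 1)) d := by
    refine IsCoprime.pow_left ((cyclotomic.irreducible_rat hn).coprime_iff_not_dvd.2 fun h => hd ?_)
    obtain ⟨t, rfl⟩ := h
    rw [map_mul, cyclotomic_eq_minpoly_rat hζ hn, minpoly.aeval, zero_mul]
  have key : f.num * d = b * a * f.denom := by
    apply RatFunc.algebraMap_injective ℚ
    have hden : algebraMap ℚ[X] (RatFunc ℚ) f.denom ≠ 0 := by
      simpa using f.denom_ne_zero
    have : algebraMap ℚ[X] (RatFunc ℚ) f.num = f * algebraMap ℚ[X] (RatFunc ℚ) f.denom := by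
      rw [← div_eq_iff hden, RatFunc.num_div_denom]
    rw [map_mul, map_mul, map_mul, this, ← e, hf]
    ring
  refine hcop.dvd_of_dvd_mul_right (key ▸ Dvd.dvd.mul_right ?_ _)
  rw [pow_succ]
  exact mul_dvd_mul hb ha

end Specialization

/-! ### Reflection symmetries and power sums at roots of unity. -/

section RootsOfUnity

variable {k : Type*} [Field k]

theorem prod_range_even_pow (q : k) (N : ℕ) :
    ∏ i ∈ Finset.range N, q ^ (2 * i + 2) = q ^ (N * (N + 1)) := by
  induction N with
  | zero => simp
  | succ N ih => rw [Finset.prod_range_succ, ih, ← pow_add]; congr 1; ring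

/-- The ratio `(ζ;ζ²)_m / (ζ²;ζ²)_m`. -/
def qRatio (ζ : k) (m : ℕ) : k :=
  ∏ i ∈ Finset.range m, (1 - ζ ^ (2 * i + 1)) / (1 - ζ ^ (2 * i + 2))

theorem qRatio_succ (ζ : k) (m : ℕ) :
    qRatio ζ (m + 1) = qRatio ζ m * ((1 - ζ ^ (2 * m + 1)) / (1 - ζ ^ (2 * m + 2))) :=
  Finset.prod_range_succ _ _

variable {ζ : k} {N : ℕ}

theorem IsPrimitiveRoot.one_sub_pow_ne_zero {n : ℕ} (hζ : IsPrimitiveRoot ζ n) {m : ℕ}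
    (h : ¬ n ∣ m) : 1 - ζ ^ m ≠ 0 :=
  fun h' => h ((hζ.pow_eq_one_iff_dvd m).1 (sub_eq_zero.1 h').symm)

theorem one_sub_odd_pow_ne_zero (hζ : IsPrimitiveRoot ζ (2 * N + 1)) {i : ℕ} (hi : i < N) :
    1 - ζ ^ (2 * i + 1) ≠ 0 :=
  hζ.one_sub_pow_ne_zero (Nat.not_dvd_of_pos_of_lt (by omega) (by omega))

theorem one_sub_even_pow_ne_zero (hζ : IsPrimitiveRoot ζ (2 * N + 1)) {i : ℕ} (hi : i < 2 * N) :
    1 - ζ ^ (2 * i + 2) ≠ 0 := by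
  refine hζ.one_sub_pow_ne_zero fun h => ?_
  rw [show 2 * i + 2 = 2 * (i + 1) by ring] at h
  have h2 : Nat.Coprime (2 * N + 1) 2 := by simp
  exact Nat.not_dvd_of_pos_of_lt (by omega) (by omega) (h2.dvd_of_dvd_mul_left h)

theorem pow_reflect_odd (hζ : IsPrimitiveRoot ζ (2 * N + 1)) {i j : ℕ} (h : i + j + 1 = N) :
    ζ ^ (2 * j + 1) = (ζ ^ (2 * i + 2))⁻¹ := by
  apply eq_inv_of_mul_eq_one_left
  rw [← pow_add, show 2 * j + 1 + (2 * i + 2) = 2 * N + 1 by omega, hζ.pow_eq_one]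

/-- Reversing the numerator turns each factor into `(1 - P⁻¹)/(1 - P) = -P⁻¹`. The fourth power is
`ζ^(-4N(N+1))`, and `4N(N+1) + 1 = n²`. -/
theorem qRatio_pow_four_top (hζ : IsPrimitiveRoot ζ (2 * N + 1)) : qRatio ζ N ^ 4 = ζ := by
  have h0 : ζ ≠ 0 := hζ.ne_zero (by omega)
  have h1 : qRatio ζ N = ∏ i ∈ Finset.range N, -(ζ ^ (2 * i + 2))⁻¹ := by
    rw [qRatio, Finset.prod_div_distrib, ← Finset.prod_range_reflect, ← Finset.prod_div_distrib]
    refine Finset.prod_congr rfl fun i hi => ?_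
    have hi := Finset.mem_range.1 hi
    have h2 := one_sub_even_pow_ne_zero hζ (show i < 2 * N by omega)
    have h3 : ζ ^ (2 * i + 2) ≠ 0 := pow_ne_zero _ h0
    rw [pow_reflect_odd hζ (show i + (N - 1 - i) + 1 = N by omega)]
    generalize ζ ^ (2 * i + 2) = P at *
    field_simp
    ring
  rw [h1, ← Finset.prod_pow]
  have h2 (i : ℕ) : (-(ζ ^ (2 * i + 2))⁻¹) ^ 4 = ((ζ ^ 4) ^ (2 * i + 2))⁻¹ := by
    rw [Even.neg_pow (by decide), inv_pow, ← pow_mul, ← pow_mul, mul_comm]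
  simp only [h2]
  rw [Finset.prod_inv_distrib, prod_range_even_pow]
  apply inv_eq_of_mul_eq_one_left
  rw [← pow_mul, ← pow_succ']
  rw [show 4 * (N * (N + 1)) + 1 = (2 * N + 1) * (2 * N + 1) by ring, pow_mul, hζ.pow_eq_one,
    one_pow]

theorem qRatio_pow_four_reflect (hζ : IsPrimitiveRoot ζ (2 * N + 1)) {m : ℕ} (hm : m ≤ N) :
    qRatio ζ (N - m) ^ 4 = ζ ^ (4 * m + 1) * qRatio ζ m ^ 4 := by
  have h0 : ζ ≠ 0 := hζ.ne_zero (by omega)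
  induction m with
  | zero => simpa [qRatio] using qRatio_pow_four_top hζ
  | succ m ih =>
    obtain ⟨j, rfl⟩ : ∃ j, N = j + m + 1 := ⟨N - m - 1, by omega⟩
    have ih := ih (by omega)
    rw [show j + m + 1 - m = j + 1 by omega, qRatio_succ,
      pow_reflect_odd hζ (show m + j + 1 = j + m + 1 by omega)] at ih
    have e := pow_reflect_odd hζ (show j + m + 1 = j + m + 1 by omega)
    rw [eq_comm, inv_eq_iff_eq_inv] at e
    rw [e] at ih
    rw [show j + m + 1 - (m + 1) = j by omega, qRatio_succ]
    have h1 := one_sub_even_pow_ne_zero hζ (show m < 2 * (j + m + 1) by omega)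
    have h2 := one_sub_odd_pow_ne_zero hζ (show m < j + m + 1 by omega)
    have hQ : ζ ^ (2 * m + 1) ≠ 0 := pow_ne_zero _ h0
    have hP : ζ ^ (2 * m + 2) ≠ 0 := pow_ne_zero _ h0
    have eP : ζ ^ (2 * m + 2) = ζ ^ (2 * m + 1) * ζ := by ring
    have e4 : ζ ^ (4 * (m + 1) + 1) = ζ ^ (4 * m + 1) * ζ ^ 4 := by ring
    rw [e4]
    rw [eP] at h1 ih ⊢
    generalize ζ ^ (2 * m + 1) = Q at *
    generalize ζ ^ (4 * m + 1) = c at *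
    generalize qRatio ζ j = a at *
    generalize qRatio ζ m = b at *
    have h3 : 1 - Q⁻¹ ≠ 0 := fun h => h2 (by rw [sub_eq_zero, eq_comm, inv_eq_one] at h; simp [h])
    have h4 : 1 - (Q * ζ)⁻¹ ≠ 0 := fun h =>
      h1 (by rw [sub_eq_zero, eq_comm, inv_eq_one] at h; simp [h])
    have e5 : (1 - (Q * ζ)⁻¹) / (1 - Q⁻¹) = (1 - Q * ζ) / ((1 - Q) * ζ) := by
      rw [div_eq_div_iff h3 (mul_ne_zero h2 h0)]
      field_simp
      ring
    rw [e5, mul_pow, div_pow, mul_div_assoc', div_eq_iff (by positivity)] at ih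
    rw [mul_pow, div_pow, mul_div_assoc', mul_div_assoc', eq_div_iff (by positivity), ih]
    ring

/-- The first-order coefficient of the perturbation of the summand, relative to the summand. -/
def qLogDeriv (ζ : k) (m : ℕ) : k :=
  ∑ i ∈ Finset.range m, ((ζ ^ (2 * i + 1)) ^ 2 / (1 - ζ ^ (2 * i + 1)) ^ 3 +
    ζ ^ (2 * i + 2) / (1 - ζ ^ (2 * i + 2)) ^ 3)

theorem div_one_sub_cube_inv {P : k} (hP : P ≠ 0) (h : 1 - P ≠ 0) :
    P⁻¹ ^ 2 / (1 - P⁻¹) ^ 3 = -(P / (1 - P) ^ 3) := by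
  have h1 : 1 - P⁻¹ = -(1 - P) / P := by field_simp; ring
  rw [h1, div_pow, Odd.neg_pow (by decide)]
  field_simp

/-- Reflection sends `ζ^(2j+1)` to the inverse of `ζ^(2i+2)`, which exchanges the two kinds of
summand with a sign. The complete sum therefore cancels, and terms can be moved from one end to the
other. -/
theorem qLogDeriv_reflect (hζ : IsPrimitiveRoot ζ (2 * N + 1)) {m : ℕ} (hm : m ≤ N) :
    qLogDeriv ζ (N - m) = qLogDeriv ζ m := by
  have h0 : ζ ≠ 0 := hζ.ne_zero (by omega)
  have step {i j : ℕ} (h : i + j + 1 = N) :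
      (ζ ^ (2 * j + 1)) ^ 2 / (1 - ζ ^ (2 * j + 1)) ^ 3 =
        -(ζ ^ (2 * i + 2) / (1 - ζ ^ (2 * i + 2)) ^ 3) := by
    rw [pow_reflect_odd hζ h]
    exact div_one_sub_cube_inv (pow_ne_zero _ h0) (one_sub_even_pow_ne_zero hζ (by omega))
  induction m with
  | zero =>
    rw [qLogDeriv, Finset.sum_add_distrib, Nat.sub_zero, ← Finset.sum_range_reflect,
      ← Finset.sum_add_distrib, qLogDeriv, Finset.sum_range_zero]
    refine Finset.sum_eq_zero fun i hi => ?_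
    have hi := Finset.mem_range.1 hi
    rw [step (show i + (N - 1 - i) + 1 = N by omega)]
    ring
  | succ m ih =>
    obtain ⟨j, rfl⟩ : ∃ j, N = j + m + 1 := ⟨N - m - 1, by omega⟩
    have ih := ih (by omega)
    rw [show j + m + 1 - m = j + 1 by omega, qLogDeriv, Finset.sum_range_succ, ← qLogDeriv] at ih
    rw [show j + m + 1 - (m + 1) = j by omega]
    conv_rhs => rw [qLogDeriv, Finset.sum_range_succ, ← qLogDeriv]
    have s1 := step (show m + j + 1 = j + m + 1 by omega)
    have s2 := step (show j + m + 1 = j + m + 1 by omega)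
    linear_combination ih - s1 - s2

theorem sum_range_eq_zero_of_antisymm [CharZero k] {F : ℕ → k}
    (h : ∀ m ≤ N, F (N - m) = -F m) : ∑ m ∈ Finset.range (N + 1), F m = 0 := by
  have h1 := Finset.sum_range_reflect F (N + 1)
  rw [Finset.sum_congr rfl fun m hm => (by
    rw [Nat.add_sub_cancel]; exact h m (Nat.lt_succ_iff.1 (Finset.mem_range.1 hm)) :
      F (N + 1 - 1 - m) = -F m), Finset.sum_neg_distrib] at h1
  exact self_eq_neg.1 h1.symm

/-- With `z = ζ^(4m+1)`, the reflected power is `z⁻¹` because the exponents add to `2n`, and `(1 -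
z⁻¹) z = -(1 - z)`. -/
theorem one_sub_pow_mul_qRatio_reflect (hζ : IsPrimitiveRoot ζ (2 * N + 1)) {m : ℕ} (hm : m ≤ N) :
    (1 - ζ ^ (4 * (N - m) + 1)) * qRatio ζ (N - m) ^ 4 =
      -((1 - ζ ^ (4 * m + 1)) * qRatio ζ m ^ 4) := by
  have h1 : ζ ^ (4 * (N - m) + 1) * ζ ^ (4 * m + 1) = 1 := by
    rw [← pow_add, show 4 * (N - m) + 1 + (4 * m + 1) = (2 * N + 1) * 2 by omega, pow_mul,
      hζ.pow_eq_one, one_pow]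
  rw [qRatio_pow_four_reflect hζ hm]
  linear_combination -(qRatio ζ m ^ 4) * h1

theorem sum_qRatio_eq_zero [CharZero k] (hζ : IsPrimitiveRoot ζ (2 * N + 1)) :
    ∑ m ∈ Finset.range (N + 1), (1 - ζ ^ (4 * m + 1)) * qRatio ζ m ^ 4 = 0 :=
  sum_range_eq_zero_of_antisymm fun _ hm => one_sub_pow_mul_qRatio_reflect hζ hm

theorem sum_qRatio_qLogDeriv_eq_zero [CharZero k] (hζ : IsPrimitiveRoot ζ (2 * N + 1)) :
    ∑ m ∈ Finset.range (N + 1), (1 - ζ ^ (4 * m + 1)) * qRatio ζ m ^ 4 * qLogDeriv ζ m = 0 :=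
  sum_range_eq_zero_of_antisymm fun m hm => by
    rw [one_sub_pow_mul_qRatio_reflect hζ hm, qLogDeriv_reflect hζ hm, neg_mul]

/-- The finite Fourier expansion of `z/(1-z)²` on nontrivial `n`-th roots of unity. -/
theorem sum_mul_pow_of_pow_eq_one {z : k} {n : ℕ} (hz : z ^ n = 1) (h1 : 1 - z ≠ 0) :
    (1 - z) ^ 2 * ∑ m ∈ Finset.range n, (m : k) * (n - m) * z ^ m = 2 * n * z := by
  -- The factor `(1-z)³` gives every partial sum a closed form provable by induction; `z^n = 1`
  -- enters only at `M = n`.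
  have h (M : ℕ) : (1 - z) ^ 3 * ∑ m ∈ Finset.range M, (m : k) * (n - m) * z ^ m =
      (n - 1 : k) * z - (n + 1) * z ^ 2 - z ^ M * (M * (n - M) * (1 - z) ^ 2 +
        (n - 2 * M - 1) * z * (1 - z) - 2 * z ^ 2) := by
    induction M with
    | zero => simp; ring
    | succ M ih => rw [Finset.sum_range_succ, mul_add, ih]; push_cast; ring
  have := h n
  rw [hz] at this
  apply mul_left_cancel₀ h1
  linear_combination this

theorem sum_range_mul_sub [CharZero k] (n : ℕ) :
    ∑ m ∈ Finset.range n, (m : k) * (n - m) = n * ((n : k) ^ 2 - 1) / 6 := by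
  have h (c : k) (M : ℕ) : ∑ m ∈ Finset.range M, (m : k) * (c - m) =
      M * (M - 1) * (3 * c - 2 * M + 1) / 6 := by
    induction M with
    | zero => simp
    | succ M ih => rw [Finset.sum_range_succ, ih]; push_cast; ring
  rw [h]; ring

/-- After Fourier expansion and exchange of sums, each inner geometric sum omits only its constant
term and is `-1`; the frequency `m = 0` has coefficient zero. -/
theorem sum_div_one_sub_sq [CharZero k] {n : ℕ} (hn : 0 < n) {ω : k} (hω : IsPrimitiveRoot ω n) :
    ∑ i ∈ Finset.range (n - 1), ω ^ (i + 1) / (1 - ω ^ (i + 1)) ^ 2 = -((n : k) ^ 2 - 1) / 12 := by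
  have hn0 : (n : k) ≠ 0 := by exact_mod_cast hn.ne'
  have h1 : ∀ i ∈ Finset.range (n - 1), ω ^ (i + 1) / (1 - ω ^ (i + 1)) ^ 2 =
      (∑ m ∈ Finset.range n, (m : k) * (n - m) * (ω ^ m) ^ (i + 1)) / (2 * n) := fun i hi => by
    have hi := Finset.mem_range.1 hi
    have h2 := hω.one_sub_pow_ne_zero (Nat.not_dvd_of_pos_of_lt (show 0 < i + 1 by omega) (by omega))
    rw [div_eq_div_iff (pow_ne_zero _ h2) (mul_ne_zero two_ne_zero hn0)]
    have := sum_mul_pow_of_pow_eq_one (z := ω ^ (i + 1)) (n := n)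
      (by rw [← pow_mul, mul_comm, pow_mul, hω.pow_eq_one, one_pow]) h2
    simp only [← pow_mul] at this ⊢
    rw [Finset.sum_congr rfl fun m _ => by rw [mul_comm m (i + 1)]]
    linear_combination -this
  rw [Finset.sum_congr rfl h1, ← Finset.sum_div, Finset.sum_comm]
  have h3 : ∀ m ∈ Finset.range n,
      ∑ i ∈ Finset.range (n - 1), (m : k) * (n - m) * (ω ^ m) ^ (i + 1) = -((m : k) * (n - m)) := by
    intro m hm
    rcases Nat.eq_zero_or_pos m with rfl | h
    · simp
    have h2 := hω.one_sub_pow_ne_zero (Nat.not_dvd_of_pos_of_lt h (Finset.mem_range.1 hm))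
    rw [← Finset.mul_sum]
    have h4 : ∑ i ∈ Finset.range (n - 1 + 1), (ω ^ m) ^ i = 0 := by
      rw [Nat.sub_add_cancel hn]
      apply mul_left_cancel₀ h2
      rw [mul_neg_geom_sum, ← pow_mul, mul_comm, pow_mul, hω.pow_eq_one]
      simp
    rw [Finset.sum_range_succ', pow_zero] at h4
    linear_combination (m : k) * (n - m) * h4
  rw [Finset.sum_congr rfl h3, Finset.sum_neg_distrib, sum_range_mul_sub]
  field_simp
  ring

/-- Half of the full sum: `P ↦ P⁻¹` preserves `P/(1-P)²` and exchanges the two halves of the range.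
-/
theorem sum_even_div_one_sub_sq [CharZero k] (hζ : IsPrimitiveRoot ζ (2 * N + 1)) :
    ∑ i ∈ Finset.range N, ζ ^ (2 * i + 2) / (1 - ζ ^ (2 * i + 2)) ^ 2 =
      -(((2 * N + 1 : ℕ) : k) ^ 2 - 1) / 24 := by
  have h0 : ζ ≠ 0 := hζ.ne_zero (by omega)
  have hω : IsPrimitiveRoot (ζ ^ 2) (2 * N + 1) := hζ.pow_of_coprime 2 (by simp)
  have h := sum_div_one_sub_sq (by omega) hω
  have e (i : ℕ) : (ζ ^ 2) ^ (i + 1) = ζ ^ (2 * i + 2) := by rw [← pow_mul]; ring_nf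
  simp only [e] at h
  rw [show 2 * N + 1 - 1 = N + N by omega, Finset.sum_range_add] at h
  have h1 : ∑ i ∈ Finset.range N, ζ ^ (2 * (N + i) + 2) / (1 - ζ ^ (2 * (N + i) + 2)) ^ 2 =
      ∑ i ∈ Finset.range N, ζ ^ (2 * i + 2) / (1 - ζ ^ (2 * i + 2)) ^ 2 := by
    rw [← Finset.sum_range_reflect]
    refine Finset.sum_congr rfl fun i hi => ?_
    have hi := Finset.mem_range.1 hi
    have h2 := one_sub_even_pow_ne_zero hζ (show i < 2 * N by omega)
    have h3 : ζ ^ (2 * i + 2) ≠ 0 := pow_ne_zero _ h0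
    have h4 : ζ ^ (2 * (N + (N - 1 - i)) + 2) = (ζ ^ (2 * i + 2))⁻¹ := by
      apply eq_inv_of_mul_eq_one_left
      rw [← pow_add,
        show 2 * (N + (N - 1 - i)) + 2 + (2 * i + 2) = (2 * N + 1) * 2 by omega, pow_mul,
        hζ.pow_eq_one, one_pow]
    rw [h4]
    generalize ζ ^ (2 * i + 2) = P at *
    have h5 : 1 - P⁻¹ = -(1 - P) / P := by field_simp; ring
    rw [h5, div_pow, neg_sq]
    field_simp
  rw [h1] at h
  linear_combination h / 2

end RootsOfUnity

/-! ### The perturbed summand, its exact sum, and first-order expansion of products. -/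

section Perturbation

variable {K : Type*} [Field K]

/-- The product `(q;q²)_k⁴ / (q²;q²)_k⁴` perturbed by a parameter `w`. -/
def perturbedRatio (q w : K) (k : ℕ) : K :=
  ∏ i ∈ Finset.range k, (1 - q ^ (2 * i + 1)) *
      ((1 - q ^ (2 * i + 1)) ^ 3 + w * (q ^ (2 * i + 1)) ^ 2) /
    ((1 - q ^ (2 * i + 2)) * ((1 - q ^ (2 * i + 2)) ^ 3 - w * q ^ (2 * i + 2)))

/-- The cubic `(1-bQ)(1-cQ)(1-Q/y)` has `e₁ = 3`, `e₃ = 1` and `e₂ = 3 + w`, hence equals `(1-Q)³ +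
wQ²`; the denominator is the reciprocal cubic `(1-P)³ - wP`. -/
theorem wellPoisedFactor_mul_terminatingFactor (q y : K) (hy : y ≠ 0) (k : ℕ) :
    wellPoisedFactor q (3 - y⁻¹) y k * terminatingFactor q y k =
      perturbedRatio q (-(1 - y) ^ 3 / y ^ 2) k := by
  rw [wellPoisedFactor, terminatingFactor, perturbedRatio, ← Finset.prod_mul_distrib]
  refine Finset.prod_congr rfl fun i _ => ?_
  rw [show q ^ (4 * i + 2) = (q ^ (2 * i + 1)) ^ 2 by rw [← pow_mul]; ring_nf,
    show q ^ (4 * i + 4) = (q ^ (2 * i + 2)) ^ 2 by rw [← pow_mul]; ring_nf]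
  generalize q ^ (2 * i + 1) = Q
  generalize q ^ (2 * i + 2) = P
  rw [div_mul_div_comm, ← mul_div_mul_left ((1 - Q) * _) _ hy]
  congr 1
  · field_simp
    ring
  · field_simp
    ring

/-- Reversal replaces `q^(2i+1)` by `y/P` with `P = q^(2i+2)`, and `(1 - y/P)(y - y/P) =
(y/P²)(1-P)(y-P)`; the factors `y/P²` multiply to `q^(-N)`. -/
theorem prod_reflected_factors (q : K) (hq : q ≠ 0) (N : ℕ) :
    (1 - q) * ∏ i ∈ Finset.range N, (1 - q ^ (2 * i + 3)) * (q ^ (2 * N + 1) - q ^ (2 * i + 1)) =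
      (1 - q ^ (2 * N + 1)) * (q ^ N)⁻¹ *
        ∏ i ∈ Finset.range N, (1 - q ^ (2 * i + 2)) * (q ^ (2 * N + 1) - q ^ (2 * i + 2)) := by
  have h1 : (1 - q) * ∏ i ∈ Finset.range N, (1 - q ^ (2 * i + 3)) =
      (1 - q ^ (2 * N + 1)) * ∏ i ∈ Finset.range N, (1 - q ^ (2 * i + 1)) := by
    have e := Finset.prod_range_succ (fun i => 1 - q ^ (2 * i + 1)) N
    rw [Finset.prod_range_succ', mul_zero, zero_add, pow_one] at e
    rw [mul_comm, mul_comm (1 - q ^ (2 * N + 1)), ← e]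
    rfl
  have h2 : ∏ i ∈ Finset.range N, q ^ (2 * N + 1) / (q ^ (2 * i + 2)) ^ 2 = (q ^ N)⁻¹ := by
    rw [Finset.prod_div_distrib, Finset.prod_pow _ 2, prod_range_even_pow, Finset.prod_const,
      Finset.card_range, ← pow_mul, ← pow_mul]
    apply eq_inv_of_mul_eq_one_left
    rw [div_mul_eq_mul_div, ← pow_add, div_eq_one_iff_eq (pow_ne_zero _ hq)]
    congr 1
    ring
  rw [Finset.prod_mul_distrib, ← mul_assoc, h1, mul_assoc, ← Finset.prod_mul_distrib,
    ← Finset.prod_range_reflect, mul_assoc, ← h2, ← Finset.prod_mul_distrib]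
  congr 1
  refine Finset.prod_congr rfl fun i hi => ?_
  have hi := Finset.mem_range.1 hi
  have h3 : q ^ (2 * (N - 1 - i) + 1) = q ^ (2 * N + 1) / q ^ (2 * i + 2) := by
    rw [eq_div_iff (pow_ne_zero _ hq), ← pow_add]
    congr 1
    omega
  have h4 : q ^ (2 * i + 2) ≠ 0 := pow_ne_zero _ hq
  rw [h3]
  field_simp
  ring

/-- The factors of the closed form become `(1-P)(y-P)/β`, whose numerator is `β - (1-y)²P/y`. -/
theorem sum_perturbedRatio (q : K) (hq1 : ∀ m : ℕ, 0 < m → 1 - q ^ m ≠ 0) (hq : q ≠ 0) (N : ℕ)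
    {y : K} (hy : y = q ^ (2 * N + 1))
    (hβ : ∀ i < N, y - (3 - y⁻¹) * q ^ (2 * i + 2) + (q ^ (2 * i + 2)) ^ 2 ≠ 0) :
    ∑ k ∈ Finset.range (N + 1), (1 - q ^ (4 * k + 1)) * perturbedRatio q (-(1 - y) ^ 3 / y ^ 2) k =
      (1 - y) * (q ^ N)⁻¹ * ∏ i ∈ Finset.range N, (1 + (1 - y) ^ 2 * -(q ^ (2 * i + 2) /
        (y * (y - (3 - y⁻¹) * q ^ (2 * i + 2) + (q ^ (2 * i + 2)) ^ 2)))) := by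
  have hy0 : y ≠ 0 := hy ▸ pow_ne_zero _ hq
  have e (i : ℕ) : q ^ (4 * i + 4) = (q ^ (2 * i + 2)) ^ 2 := by rw [← pow_mul]; ring_nf
  have key := sum_wellPoised q (3 - y⁻¹) y hq1 hq N fun i hi => by rw [e]; exact hβ i hi
  rw [← hy] at key
  simp only [mul_assoc, wellPoisedFactor_mul_terminatingFactor q y hy0] at key
  rw [key, Finset.prod_div_distrib, mul_div_assoc', hy, prod_reflected_factors q hq, ← hy, mul_assoc,
    mul_div_assoc, mul_div_assoc, ← Finset.prod_div_distrib]
  rw [← mul_assoc (1 - y)]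
  congr 1
  refine Finset.prod_congr rfl fun i hi => ?_
  have h1 := hβ i (Finset.mem_range.1 hi)
  rw [e]
  generalize q ^ (2 * i + 2) = P at *
  obtain ⟨β, eβ⟩ : ∃ β, β = y - (3 - y⁻¹) * P + P ^ 2 := ⟨_, rfl⟩
  rw [← eβ] at h1 ⊢
  have e' : y * β = y ^ 2 - (3 * y - 1) * P + y * P ^ 2 := by rw [eβ]; field_simp
  field_simp
  linear_combination -e'

/-- The subring keeps the quadratic remainder regular at `ζ` when applied to `regularAt ζ`. -/
theorem prod_first_order (S : Subring K) {w : K} (hw : w ∈ S) {F G l m : ℕ → K} (k : ℕ)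
    (hG : ∀ i < k, G i ∈ S) (hl : ∀ i < k, l i ∈ S) (hm : ∀ i < k, m i ∈ S)
    (h : ∀ i < k, F i = G i * (1 + w * l i + w ^ 2 * m i)) :
    ∃ Y ∈ S, ∏ i ∈ Finset.range k, F i =
      (∏ i ∈ Finset.range k, G i) * (1 + w * ∑ i ∈ Finset.range k, l i) + w ^ 2 * Y := by
  induction k with
  | zero => exact ⟨0, S.zero_mem, by simp⟩
  | succ k ih =>
    obtain ⟨Y, hY, e⟩ := ih (fun i hi => hG i (by omega)) (fun i hi => hl i (by omega))
      (fun i hi => hm i (by omega)) (fun i hi => h i (by omega))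
    have hA : ∏ i ∈ Finset.range k, G i ∈ S :=
      S.prod_mem fun i hi => hG i (by have := Finset.mem_range.1 hi; omega)
    have hL : ∑ i ∈ Finset.range k, l i ∈ S :=
      S.sum_mem fun i hi => hl i (by have := Finset.mem_range.1 hi; omega)
    have hg := hG k (by omega)
    have hlk := hl k (by omega)
    have hmk := hm k (by omega)
    rw [Finset.prod_range_succ, Finset.prod_range_succ, Finset.sum_range_succ, e, h k (by omega)]
    generalize ∏ i ∈ Finset.range k, G i = A at *
    generalize ∑ i ∈ Finset.range k, l i = L at *
    refine ⟨A * G k * (L * l k + (1 + w * L) * m k) + Y * G k * (1 + w * l k + w ^ 2 * m k), ?_,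
      by ring⟩
    have h1 := S.one_mem
    have hx {a b : K} : a ∈ S → b ∈ S → a * b ∈ S := S.mul_mem
    exact S.add_mem (hx (hx hA hg) (S.add_mem (hx hL hlk) (hx (S.add_mem h1 (hx hw hL)) hmk)))
      (hx (hx hY hg) (S.add_mem (S.add_mem h1 (hx hw hlk)) (hx (S.pow_mem hw 2) hmk)))

end Perturbation

/-! ### The short sum modulo `Φ_n⁴`. -/

section HighestCyclotomicFactor

/-- The ring of rational functions that are regular at `ζ`. -/
def regularAt (ζ : ℂ) : Subring (RatFunc ℚ) where
  carrier := {f | ∃ c, SpecializesTo ζ f c}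
  mul_mem' := fun ⟨_, h⟩ ⟨_, h'⟩ => ⟨_, h.mul h'⟩
  one_mem' := ⟨_, .one ζ⟩
  add_mem' := fun ⟨_, h⟩ ⟨_, h'⟩ => ⟨_, h.add h'⟩
  zero_mem' := ⟨_, .zero ζ⟩
  neg_mem' := fun ⟨_, h⟩ => ⟨_, h.neg⟩

theorem SpecializesTo.mem {ζ c : ℂ} {f : RatFunc ℚ} (h : SpecializesTo ζ f c) : f ∈ regularAt ζ :=
  ⟨c, h⟩

theorem one_sub_X_pow_ne_zero {m : ℕ} (hm : 0 < m) : (1 : RatFunc ℚ) - RatFunc.X ^ m ≠ 0 := by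
  refine (SpecializesTo.one_sub_X_pow 0 m).ne_zero ?_
  simp [hm.ne']

theorem one_sub_mul_qInteger {R : Type*} [CommRing R] (q : R) (m : ℕ) :
    (1 - q) * qInteger q m = 1 - q ^ m := mul_neg_geom_sum q m

theorem qShiftedFactorial_div {K : Type*} [Field K] (q : K) (k : ℕ) :
    qShiftedFactorial q (q ^ 2) k / qShiftedFactorial (q ^ 2) (q ^ 2) k = qRatio q k := by
  rw [qShiftedFactorial, qShiftedFactorial, qRatio, ← Finset.prod_div_distrib]
  refine Finset.prod_congr rfl fun i _ => ?_
  congr 2 <;> rw [← pow_mul] <;> ring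

theorem one_sub_X_mul_truncatedSum (M : ℕ) : (1 - RatFunc.X) * truncatedSum M =
    ∑ k ∈ Finset.range (M + 1), (1 - RatFunc.X ^ (4 * k + 1)) * qRatio RatFunc.X k ^ 4 := by
  simp only [truncatedSum]
  rw [Finset.mul_sum]
  refine Finset.sum_congr rfl fun k _ => ?_
  rw [mul_div_assoc, ← div_pow, qShiftedFactorial_div, ← mul_assoc, one_sub_mul_qInteger]

theorem one_sub_X_mul_congruenceRHS (N : ℕ) : (1 - RatFunc.X) * congruenceRHS (2 * N + 1) =
    (RatFunc.X ^ N)⁻¹ * ((1 - RatFunc.X ^ (2 * N + 1)) + (((2 * N + 1 : ℕ) : RatFunc ℚ) ^ 2 - 1) / 24 *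
      (1 - RatFunc.X ^ (2 * N + 1)) ^ 3) := by
  have e : (1 - ((2 * N + 1 : ℕ) : ℤ)) / 2 = -(N : ℤ) := by omega
  simp only [congruenceRHS]
  rw [e, zpow_neg, zpow_natCast, ← one_sub_mul_qInteger]
  ring

variable {ζ : ℂ} {N : ℕ}

theorem SpecializesTo.qRatio {m : ℕ} (h : ∀ i < m, 1 - ζ ^ (2 * i + 2) ≠ 0) :
    SpecializesTo ζ (qRatio RatFunc.X m) (_root_.qRatio ζ m) :=
  .prod fun i hi => (one_sub_X_pow ζ _).div (one_sub_X_pow ζ _) (h i (Finset.mem_range.1 hi))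

theorem SpecializesTo.qLogDeriv {m : ℕ} (h : ∀ i < m, 1 - ζ ^ (2 * i + 2) ≠ 0)
    (h' : ∀ i < m, 1 - ζ ^ (2 * i + 1) ≠ 0) :
    SpecializesTo ζ (qLogDeriv RatFunc.X m) (_root_.qLogDeriv ζ m) :=
  .sum fun i hi => .add
    ((((X ζ).pow _).pow 2).div ((one_sub_X_pow ζ _).pow 3)
      (pow_ne_zero _ (h' i (Finset.mem_range.1 hi))))
    (((X ζ).pow _).div ((one_sub_X_pow ζ _).pow 3) (pow_ne_zero _ (h i (Finset.mem_range.1 hi))))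

theorem perturbedRatio_first_order (hζ : IsPrimitiveRoot ζ (2 * N + 1)) {w : RatFunc ℚ}
    (hw : SpecializesTo ζ w 0) {k : ℕ} (hk : k ≤ N) :
    ∃ Y ∈ regularAt ζ, perturbedRatio RatFunc.X w k =
      qRatio RatFunc.X k ^ 4 * (1 + w * qLogDeriv RatFunc.X k) + w ^ 2 * Y := by
  set q : RatFunc ℚ := RatFunc.X with hq
  have hP (i : ℕ) (hi : i < k) := one_sub_even_pow_ne_zero hζ (show i < 2 * N by omega)
  have hQ (i : ℕ) (hi : i < k) := one_sub_odd_pow_ne_zero hζ (show i < N by omega)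
  have sQ (i : ℕ) := SpecializesTo.one_sub_X_pow ζ (2 * i + 1)
  have sP (i : ℕ) := SpecializesTo.one_sub_X_pow ζ (2 * i + 2)
  have sb (i : ℕ) (hi : i < k) : SpecializesTo ζ (q ^ (2 * i + 2) / (1 - q ^ (2 * i + 2)) ^ 3) _ :=
    ((SpecializesTo.X ζ).pow _).div ((sP i).pow 3) (pow_ne_zero _ (hP i hi))
  have sl (i : ℕ) (hi : i < k) :
      SpecializesTo ζ ((q ^ (2 * i + 1)) ^ 2 / (1 - q ^ (2 * i + 1)) ^ 3 +
        q ^ (2 * i + 2) / (1 - q ^ (2 * i + 2)) ^ 3) _ :=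
    ((((SpecializesTo.X ζ).pow _).pow 2).div ((sQ i).pow 3) (pow_ne_zero _ (hQ i hi))).add (sb i hi)
  have sd (i : ℕ) (hi : i < k) :
      SpecializesTo ζ (1 - w * (q ^ (2 * i + 2) / (1 - q ^ (2 * i + 2)) ^ 3)) 1 :=
    ((SpecializesTo.one ζ).sub (hw.mul (sb i hi))).of_eq (by ring)
  have := prod_first_order (regularAt ζ) hw.mem k
    (F := fun i => (1 - q ^ (2 * i + 1)) *
      ((1 - q ^ (2 * i + 1)) ^ 3 + w * (q ^ (2 * i + 1)) ^ 2) /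
      ((1 - q ^ (2 * i + 2)) * ((1 - q ^ (2 * i + 2)) ^ 3 - w * q ^ (2 * i + 2))))
    (G := fun i => ((1 - q ^ (2 * i + 1)) / (1 - q ^ (2 * i + 2))) ^ 4)
    (l := fun i => (q ^ (2 * i + 1)) ^ 2 / (1 - q ^ (2 * i + 1)) ^ 3 +
      q ^ (2 * i + 2) / (1 - q ^ (2 * i + 2)) ^ 3)
    -- From `(1+wa)/(1-wb) = 1 + w(a+b) + w² b(a+b)/(1-wb)`.
    (m := fun i => q ^ (2 * i + 2) / (1 - q ^ (2 * i + 2)) ^ 3 *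
      ((q ^ (2 * i + 1)) ^ 2 / (1 - q ^ (2 * i + 1)) ^ 3 +
        q ^ (2 * i + 2) / (1 - q ^ (2 * i + 2)) ^ 3) /
      (1 - w * (q ^ (2 * i + 2) / (1 - q ^ (2 * i + 2)) ^ 3)))
    (fun i hi => (((sQ i).div (sP i) (hP i hi)).pow 4).mem) (fun i hi => (sl i hi).mem)
    (fun i hi => (((sb i hi).mul (sl i hi)).div (sd i hi) one_ne_zero).mem)
    (fun i hi => ?_)
  · obtain ⟨Y, hY, e⟩ := this
    exact ⟨Y, hY, by rw [perturbedRatio, e, Finset.prod_pow, ← qRatio, ← qLogDeriv]⟩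
  · have h1 := (sQ i).ne_zero (hQ i hi)
    have h2 := (sP i).ne_zero (hP i hi)
    have h3 := (sd i hi).ne_zero one_ne_zero
    rw [← hq] at h1 h2
    generalize q ^ (2 * i + 1) = Q at *
    generalize q ^ (2 * i + 2) = P at *
    obtain ⟨c, ec⟩ : ∃ c, c = 1 - Q := ⟨_, rfl⟩
    obtain ⟨d, ed⟩ : ∃ d, d = 1 - P := ⟨_, rfl⟩
    rw [← ec] at h1 ⊢
    rw [← ed] at h2 h3 ⊢
    have e3 : 1 - w * (P / d ^ 3) = (d ^ 3 - w * P) / d ^ 3 := by field_simp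
    have h4 : d ^ 3 - w * P ≠ 0 := fun h => h3 (by rw [e3, h, zero_div])
    rw [e3]
    clear e3 h3
    generalize eD : d ^ 3 - w * P = D at *
    field_simp
    subst eD
    ring

theorem cyclotomic_pow_four_dvd_num (hN : 0 < N) (hζ : IsPrimitiveRoot ζ (2 * N + 1)) :
    cyclotomic (2 * N + 1) ℚ ^ 4 ∣ (truncatedSum N - congruenceRHS (2 * N + 1)).num := by
  have hζ0 : ζ ≠ 0 := hζ.ne_zero (by omega)
  have hζ1 : 1 - ζ ≠ 0 := by simpa using one_sub_odd_pow_ne_zero hζ hN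
  have hP (i : ℕ) (hi : i < N) := one_sub_even_pow_ne_zero hζ (show i < 2 * N by omega)
  have hQ (i : ℕ) (hi : i < N) := one_sub_odd_pow_ne_zero hζ hi
  set q : RatFunc ℚ := RatFunc.X with hq
  have sq : SpecializesTo ζ q ζ := SpecializesTo.X ζ
  obtain ⟨y, hy⟩ : ∃ y, y = q ^ (2 * N + 1) := ⟨_, rfl⟩
  have sy : SpecializesTo ζ y 1 := hy ▸ (sq.pow _).of_eq hζ.pow_eq_one
  have hy0 : y ≠ 0 := sy.ne_zero one_ne_zero
  have su : SpecializesTo ζ (1 - y) 0 := ((SpecializesTo.one ζ).sub sy).of_eq (sub_self 1)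
  obtain ⟨w, ew⟩ : ∃ w, w = -(1 - y) ^ 3 / y ^ 2 := ⟨_, rfl⟩
  have sw : SpecializesTo ζ w 0 := by
    rw [ew]; exact ((su.pow 3).neg.div (sy.pow 2) (by simp)).of_eq (by simp)
  have sy' := sy.inv one_ne_zero
  have sβ (i : ℕ) : SpecializesTo ζ (y - (3 - y⁻¹) * q ^ (2 * i + 2) + (q ^ (2 * i + 2)) ^ 2)
      ((1 - ζ ^ (2 * i + 2)) ^ 2) :=
    ((sy.sub (((SpecializesTo.natCast ζ 3).sub sy').mul (sq.pow _))).add ((sq.pow _).pow 2)).of_eq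
      (by push_cast; ring)
  have key := sum_perturbedRatio q (fun m hm => one_sub_X_pow_ne_zero hm) RatFunc.X_ne_zero N hy
    fun i hi => (sβ i).ne_zero (pow_ne_zero _ (hP i hi))
  rw [← ew] at key
  -- first-order expansion of the left-hand side
  have hex (k : ℕ) (hk : k ∈ Finset.range (N + 1)) :=
    perturbedRatio_first_order hζ sw (Nat.lt_succ_iff.1 (Finset.mem_range.1 hk))
  choose! Y hY eY using hex
  have sY : ∑ k ∈ Finset.range (N + 1), (1 - q ^ (4 * k + 1)) * Y k ∈ regularAt ζ :=
    Subring.sum_mem _ fun k hk =>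
      Subring.mul_mem _ (SpecializesTo.one_sub_X_pow ζ _).mem (hY k hk)
  have sX : SpecializesTo ζ (∑ k ∈ Finset.range (N + 1),
      (1 - q ^ (4 * k + 1)) * qRatio q k ^ 4 * qLogDeriv q k) 0 :=
    (SpecializesTo.sum fun k hk => by
      have hk := Finset.mem_range.1 hk
      have h1 (i : ℕ) (hi : i < k) := hP i (by omega)
      have h2 (i : ℕ) (hi : i < k) := hQ i (by omega)
      exact ((SpecializesTo.one_sub_X_pow ζ _).mul ((SpecializesTo.qRatio h1).pow 4)).mul
        (SpecializesTo.qLogDeriv h1 h2)).of_eq (sum_qRatio_qLogDeriv_eq_zero hζ)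
  have eL : ∑ k ∈ Finset.range (N + 1), (1 - q ^ (4 * k + 1)) * perturbedRatio q w k =
      (1 - q) * truncatedSum N +
        w * ∑ k ∈ Finset.range (N + 1), (1 - q ^ (4 * k + 1)) * qRatio q k ^ 4 * qLogDeriv q k +
        w ^ 2 * ∑ k ∈ Finset.range (N + 1), (1 - q ^ (4 * k + 1)) * Y k := by
    rw [one_sub_X_mul_truncatedSum, Finset.mul_sum, Finset.mul_sum, ← Finset.sum_add_distrib,
      ← Finset.sum_add_distrib]
    refine Finset.sum_congr rfl fun k hk => ?_
    rw [eY k hk]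
    ring
  -- expansion of the right-hand side
  have sx (i : ℕ) (hi : i < N) : SpecializesTo ζ (-(q ^ (2 * i + 2) /
      (y * (y - (3 - y⁻¹) * q ^ (2 * i + 2) + (q ^ (2 * i + 2)) ^ 2))))
      (-(ζ ^ (2 * i + 2) / (1 - ζ ^ (2 * i + 2)) ^ 2)) :=
    ((sq.pow _).div (sy.mul (sβ i)) (by simpa using hP i hi)).neg.of_eq (by rw [one_mul])
  obtain ⟨Z, hZ, eZ⟩ := prod_first_order (regularAt ζ) (su.pow 2).mem N (G := fun _ => 1)
    (m := fun _ => 0) (fun _ _ => Subring.one_mem _) (fun i hi => (sx i hi).mem)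
    (fun _ _ => Subring.zero_mem _) (fun i hi => by rw [one_mul, mul_zero, add_zero])
  have sL := (SpecializesTo.sum fun i hi => sx i (Finset.mem_range.1 hi)).of_eq
    (by rw [Finset.sum_neg_distrib, sum_even_div_one_sub_sq hζ])
  rw [eL, eZ, Finset.prod_const_one, one_mul] at key
  have eR := one_sub_X_mul_congruenceRHS N
  rw [← hq, ← hy] at eR
  generalize ∑ i ∈ Finset.range N, -(q ^ (2 * i + 2) /
      (y * (y - (3 - y⁻¹) * q ^ (2 * i + 2) + (q ^ (2 * i + 2)) ^ 2))) = L at *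
  generalize ∑ k ∈ Finset.range (N + 1),
    (1 - q ^ (4 * k + 1)) * qRatio q k ^ 4 * qLogDeriv q k = X at *
  generalize ∑ k ∈ Finset.range (N + 1), (1 - q ^ (4 * k + 1)) * Y k = Y' at *
  obtain ⟨_, sY⟩ := sY
  obtain ⟨_, sZ⟩ := hZ
  have sq1 : SpecializesTo ζ (1 - q) (1 - ζ) := (SpecializesTo.one ζ).sub sq
  have hq1 := sq1.ne_zero hζ1
  have sn : SpecializesTo ζ (((2 * N + 1 : ℕ) : RatFunc ℚ) ^ 2 - 1) _ :=
    ((SpecializesTo.natCast ζ (2 * N + 1)).pow 2).sub (SpecializesTo.one ζ)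
  have s24 : SpecializesTo ζ (24 : RatFunc ℚ) 24 := by simpa using SpecializesTo.natCast ζ 24
  -- This is the difference of the two sides divided by `(1-y)³`. At `ζ` the value of `L` cancels
  -- `(n²-1)/24`, `X` vanishes, and the other terms retain a power of `1-y`.
  have sg : SpecializesTo ζ (((q ^ N)⁻¹ * (L - (((2 * N + 1 : ℕ) : RatFunc ℚ) ^ 2 - 1) / 24 +
      (1 - y) ^ 2 * Z) + X / y ^ 2 - (1 - y) ^ 3 / y ^ 4 * Y') / (1 - q)) 0 :=
    (SpecializesTo.div (.sub (.add (((sq.pow N).inv (pow_ne_zero _ hζ0)).mul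
      ((sL.sub (sn.div s24 (by norm_num))).add ((su.pow 2).mul sZ))) (sX.div (sy.pow 2) (by simp)))
      (((su.pow 3).div (sy.pow 4) (by simp)).mul sY)) sq1 hζ1).of_eq (by ring)
  refine cyclotomic_pow_dvd_num (Nat.succ_pos _) hζ 3 (b := (1 - Polynomial.X ^ (2 * N + 1)) ^ 3)
    (pow_dvd_pow_of_dvd ?_ 3) sg ?_
  · exact cyclotomic_dvd_of_aeval_eq_zero (Nat.succ_pos _) hζ (by simp [hζ.pow_eq_one])
  · have e1 : algebraMap ℚ[X] (RatFunc ℚ) ((1 - Polynomial.X ^ (2 * N + 1)) ^ 3) = (1 - y) ^ 3 := by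
      simp [hy, hq]
    rw [e1, mul_div_assoc', eq_div_iff hq1, sub_mul, mul_comm _ (1 - q), mul_comm _ (1 - q), eR,
      eq_sub_of_add_eq (eq_sub_of_add_eq key)]
    rw [ew]
    generalize (q ^ N)⁻¹ = t
    field_simp
    ring

end HighestCyclotomicFactor

/-! ### The long sum modulo `Φ_n⁴`. -/

section SecondHalf

/-- A divisor of a numerator in lowest terms is coprime to the denominator, so it survives clearing
denominators and later cancellation. -/
theorem dvd_num_add {P : ℚ[X]} {f g : RatFunc ℚ} (hf : P ∣ f.num) (hg : P ∣ g.num) :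
    P ∣ (f + g).num := by
  have hf' : IsCoprime P f.denom := (RatFunc.isCoprime_num_denom f).of_isCoprime_of_dvd_left hf
  have hg' : IsCoprime P g.denom := (RatFunc.isCoprime_num_denom g).of_isCoprime_of_dvd_left hg
  refine (hf'.mul_right hg').dvd_of_dvd_mul_right ?_
  rw [RatFunc.num_denom_add]
  exact (dvd_add (hf.mul_right _) (hg.mul_left _)).mul_right _

theorem qRatio_eq_mul_of_lt {K : Type*} [Field K] (q : K) {N k : ℕ} (h : N < k) :
    qRatio q k = (1 - q ^ (2 * N + 1)) * ((∏ i ∈ (Finset.range k).erase N, (1 - q ^ (2 * i + 1))) /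
      ∏ i ∈ Finset.range k, (1 - q ^ (2 * i + 2))) := by
  rw [qRatio, Finset.prod_div_distrib, ← Finset.mul_prod_erase _ _ (Finset.mem_range.2 h),
    mul_div_assoc]

theorem truncatedSum_two_mul (N : ℕ) : (1 - RatFunc.X) * truncatedSum (2 * N) =
    (1 - RatFunc.X) * truncatedSum N + ∑ j ∈ Finset.range N,
      (1 - RatFunc.X ^ (4 * (N + 1 + j) + 1)) * qRatio RatFunc.X (N + 1 + j) ^ 4 := by
  rw [one_sub_X_mul_truncatedSum, one_sub_X_mul_truncatedSum,
    show 2 * N + 1 = N + 1 + N by ring, Finset.sum_range_add]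

variable {ζ : ℂ} {N : ℕ}

theorem cyclotomic_pow_four_dvd_num_two_mul (hN : 0 < N) (hζ : IsPrimitiveRoot ζ (2 * N + 1)) :
    cyclotomic (2 * N + 1) ℚ ^ 4 ∣ (truncatedSum (2 * N) - congruenceRHS (2 * N + 1)).num := by
  have hζ1 : 1 - ζ ≠ 0 := by simpa using one_sub_odd_pow_ne_zero hζ hN
  set q : RatFunc ℚ := RatFunc.X with hq
  have sq1 : SpecializesTo ζ (1 - q) (1 - ζ) := (SpecializesTo.one ζ).sub (SpecializesTo.X ζ)
  have hq1 := sq1.ne_zero hζ1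
  have e : truncatedSum (2 * N) - congruenceRHS (2 * N + 1) =
      (truncatedSum N - congruenceRHS (2 * N + 1)) + (∑ j ∈ Finset.range N,
        (1 - q ^ (4 * (N + 1 + j) + 1)) * qRatio q (N + 1 + j) ^ 4) / (1 - q) := by
    have h := truncatedSum_two_mul N
    rw [← hq] at h
    apply mul_left_cancel₀ hq1
    rw [mul_add, mul_div_cancel₀ _ hq1]
    linear_combination h
  rw [e]
  refine dvd_num_add (cyclotomic_pow_four_dvd_num hN hζ) ?_
  have s1 (j : ℕ) (hj : j < N) : SpecializesTo ζ
      ((∏ i ∈ (Finset.range (N + 1 + j)).erase N, (1 - q ^ (2 * i + 1))) /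
        ∏ i ∈ Finset.range (N + 1 + j), (1 - q ^ (2 * i + 2))) _ :=
    (SpecializesTo.prod fun i _ => SpecializesTo.one_sub_X_pow ζ _).div
      (SpecializesTo.prod fun i _ => SpecializesTo.one_sub_X_pow ζ _)
      (Finset.prod_ne_zero_iff.2 fun i hi =>
        one_sub_even_pow_ne_zero hζ (by have := Finset.mem_range.1 hi; omega))
  have sy : SpecializesTo ζ (1 - q ^ (2 * N + 1)) 0 :=
    (SpecializesTo.one_sub_X_pow ζ _).of_eq (by rw [hζ.pow_eq_one, sub_self])
  have s2 := ((sy.mul (SpecializesTo.sum fun j hj => (SpecializesTo.one_sub_X_pow ζ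
    (4 * (N + 1 + j) + 1)).mul ((s1 j (Finset.mem_range.1 hj)).pow 4))).div sq1 hζ1).of_eq
      (by rw [zero_mul, zero_div])
  -- Of the four factors `1-q^n`, three form `b` and the fourth is the zero recorded in `s2`.
  refine cyclotomic_pow_dvd_num (Nat.succ_pos _) hζ 3 (b := (1 - Polynomial.X ^ (2 * N + 1)) ^ 3)
    (pow_dvd_pow_of_dvd ?_ 3) s2 ?_
  · exact cyclotomic_dvd_of_aeval_eq_zero (Nat.succ_pos _) hζ (by simp [hζ.pow_eq_one])
  · have e1 : algebraMap ℚ[X] (RatFunc ℚ) ((1 - Polynomial.X ^ (2 * N + 1)) ^ 3) =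
        (1 - q ^ (2 * N + 1)) ^ 3 := by simp [hq]
    rw [e1, mul_div_assoc', ← mul_assoc, ← pow_succ, Finset.mul_sum]
    congr 1
    refine Finset.sum_congr rfl fun j _ => ?_
    rw [qRatio_eq_mul_of_lt q (show N < N + 1 + j by omega)]
    ring

end SecondHalf

/-! ### Vanishing modulo `Φ_d` for every divisor `d ≠ 1` of `n`. -/

section ProperDivisors

variable {ζ : ℂ} {D : ℕ}

theorem qRatio_add {K : Type*} [Field K] (q : K) (m j : ℕ) :
    qRatio q (m + j) = qRatio q m * ∏ i ∈ Finset.range j,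
      (1 - q ^ (2 * (m + i) + 1)) / (1 - q ^ (2 * (m + i) + 2)) :=
  Finset.prod_range_add _ _ _

theorem one_sub_pow_shift (hζ : IsPrimitiveRoot ζ (2 * D + 1)) {a b c : ℕ}
    (h : a = (2 * D + 1) * c + b) : 1 - ζ ^ a = 1 - ζ ^ b := by
  rw [h, pow_add, pow_mul, hζ.pow_eq_one, one_pow, one_mul]

/-- In a block of length `d = 2D+1`, the only factors vanishing at `ζ` are the numerator at `i = D`
and the denominator at `i = 2D`. Their common factor `1-q^d` cancels, leaving `(2l+1)/(2l+2)` at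
`ζ`. -/
theorem specializesTo_qRatio_block (hζ : IsPrimitiveRoot ζ (2 * D + 1)) (l : ℕ) :
    ∃ c, SpecializesTo ζ (qRatio RatFunc.X ((2 * D + 1) * l)) c := by
  induction l with
  | zero => exact ⟨1, by simpa [qRatio] using SpecializesTo.one ζ⟩
  | succ l ih =>
    obtain ⟨c, hc⟩ := ih
    set q : RatFunc ℚ := RatFunc.X
    set d := 2 * D + 1 with hd
    have e : qRatio q (d * (l + 1)) = qRatio q (d * l) *
        ((∏ i ∈ (Finset.range d).erase D, (1 - q ^ (2 * (d * l + i) + 1))) *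
          (qInteger (q ^ d) (2 * l + 1) / qInteger (q ^ d) (2 * l + 2)) /
          ∏ i ∈ Finset.range (2 * D), (1 - q ^ (2 * (d * l + i) + 2))) := by
      rw [mul_add, mul_one, qRatio_add, Finset.prod_div_distrib,
        ← Finset.mul_prod_erase (Finset.range d) _ (Finset.mem_range.2 (show D < d by omega)), hd,
        Finset.prod_range_succ (fun i => 1 - q ^ (2 * ((2 * D + 1) * l + i) + 2)), ← hd]
      have e1 : 1 - q ^ (2 * (d * l + D) + 1) = (1 - q ^ d) * qInteger (q ^ d) (2 * l + 1) := by
        rw [one_sub_mul_qInteger, ← pow_mul]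
        congr 2; rw [hd]; ring
      have e2 : 1 - q ^ (2 * (d * l + 2 * D) + 2) = (1 - q ^ d) * qInteger (q ^ d) (2 * l + 2) := by
        rw [one_sub_mul_qInteger, ← pow_mul]
        congr 2; rw [hd]; ring
      have h0 : 1 - q ^ d ≠ 0 := one_sub_X_pow_ne_zero (by omega)
      rw [e1, e2, mul_assoc (1 - q ^ d), mul_left_comm _ (1 - q ^ d), mul_div_mul_left _ _ h0]
      ring
    have sI (m : ℕ) : SpecializesTo ζ (qInteger (q ^ d) m) m :=
      (((SpecializesTo.X ζ).pow d).qInteger m).of_eq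
        (by rw [hζ.pow_eq_one]; simp [qInteger])
    rw [e]
    refine ⟨_, hc.mul (.div (.mul (.prod fun i _ => SpecializesTo.one_sub_X_pow ζ _)
      ((sI _).div (sI _) (Nat.cast_ne_zero.2 (Nat.succ_ne_zero _))))
      (.prod fun i _ => SpecializesTo.one_sub_X_pow ζ _) (Finset.prod_ne_zero_iff.2 fun i hi => ?_))⟩
    rw [one_sub_pow_shift hζ (c := 2 * l) (b := 2 * i + 2) (by rw [hd]; ring)]
    exact one_sub_even_pow_ne_zero hζ (Finset.mem_range.1 hi)

theorem specializesTo_qRatio_block_add (hζ : IsPrimitiveRoot ζ (2 * D + 1)) {l : ℕ} {c : ℂ}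
    (hc : SpecializesTo ζ (qRatio RatFunc.X ((2 * D + 1) * l)) c) {j : ℕ} (hj : j ≤ 2 * D) :
    SpecializesTo ζ (qRatio RatFunc.X ((2 * D + 1) * l + j)) (c * qRatio ζ j) := by
  rw [qRatio_add]
  refine hc.mul (.prod fun i hi => ?_)
  have hi := Finset.mem_range.1 hi
  have h1 := one_sub_pow_shift hζ (a := 2 * ((2 * D + 1) * l + i) + 1) (c := 2 * l)
    (b := 2 * i + 1) (by ring)
  have h2 := one_sub_pow_shift hζ (a := 2 * ((2 * D + 1) * l + i) + 2) (c := 2 * l)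
    (b := 2 * i + 2) (by ring)
  rw [← h1, ← h2]
  exact (SpecializesTo.one_sub_X_pow ζ _).div (SpecializesTo.one_sub_X_pow ζ _)
    (h2 ▸ one_sub_even_pow_ne_zero hζ (by omega))

/-- At `ζ`, the terms of block `l` are those of block zero times the common constant `c⁴`. -/
theorem specializesTo_sum_block (hζ : IsPrimitiveRoot ζ (2 * D + 1)) (l : ℕ) {J : ℕ}
    (hJ : J ≤ 2 * D + 1)
    (h0 : ∑ j ∈ Finset.range J, (1 - ζ ^ (4 * j + 1)) * qRatio ζ j ^ 4 = 0) :
    SpecializesTo ζ (∑ j ∈ Finset.range J, (1 - RatFunc.X ^ (4 * ((2 * D + 1) * l + j) + 1)) *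
      qRatio RatFunc.X ((2 * D + 1) * l + j) ^ 4) 0 := by
  obtain ⟨c, hc⟩ := specializesTo_qRatio_block hζ l
  refine (SpecializesTo.sum fun j hj => (SpecializesTo.one_sub_X_pow ζ _).mul
    ((specializesTo_qRatio_block_add hζ hc
      (by have := Finset.mem_range.1 hj; omega)).pow 4)).of_eq ?_
  rw [← mul_zero (c ^ 4), ← h0, Finset.mul_sum]
  refine Finset.sum_congr rfl fun j _ => ?_
  rw [one_sub_pow_shift hζ (c := 4 * l) (b := 4 * j + 1) (by ring)]
  ring

theorem sum_qRatio_full_eq_zero (hζ : IsPrimitiveRoot ζ (2 * D + 1)) :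
    ∑ j ∈ Finset.range (2 * D + 1), (1 - ζ ^ (4 * j + 1)) * qRatio ζ j ^ 4 = 0 := by
  rw [show 2 * D + 1 = D + 1 + D by ring, Finset.sum_range_add, sum_qRatio_eq_zero hζ, zero_add]
  refine Finset.sum_eq_zero fun j _ => ?_
  rw [qRatio_eq_mul_of_lt ζ (show D < D + 1 + j by omega), hζ.pow_eq_one]
  ring

theorem specializesTo_sum_full (hζ : IsPrimitiveRoot ζ (2 * D + 1)) (e : ℕ) :
    SpecializesTo ζ (∑ k ∈ Finset.range ((2 * D + 1) * e),
      (1 - RatFunc.X ^ (4 * k + 1)) * qRatio RatFunc.X k ^ 4) 0 := by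
  induction e with
  | zero => simpa using SpecializesTo.zero ζ
  | succ e ih =>
    rw [mul_add, mul_one, Finset.sum_range_add]
    exact (ih.add (specializesTo_sum_block hζ e le_rfl (sum_qRatio_full_eq_zero hζ))).of_eq
      (add_zero 0)

theorem specializesTo_sum_half (hζ : IsPrimitiveRoot ζ (2 * D + 1)) (e : ℕ) :
    SpecializesTo ζ (∑ k ∈ Finset.range ((2 * D + 1) * e + (D + 1)),
      (1 - RatFunc.X ^ (4 * k + 1)) * qRatio RatFunc.X k ^ 4) 0 := by
  rw [Finset.sum_range_add]
  exact ((specializesTo_sum_full hζ e).add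
    (specializesTo_sum_block hζ e (by omega) (sum_qRatio_eq_zero hζ))).of_eq (add_zero 0)

theorem cyclotomic_dvd_num_of_specializesTo (hD : 0 < D) (hζ : IsPrimitiveRoot ζ (2 * D + 1))
    {N : ℕ} (hN : 2 * D + 1 ∣ 2 * N + 1) {M : ℕ}
    (h : SpecializesTo ζ (∑ k ∈ Finset.range (M + 1),
      (1 - RatFunc.X ^ (4 * k + 1)) * qRatio RatFunc.X k ^ 4) 0) :
    cyclotomic (2 * D + 1) ℚ ∣ (truncatedSum M - congruenceRHS (2 * N + 1)).num := by
  have hζ1 : 1 - ζ ≠ 0 := by simpa using one_sub_odd_pow_ne_zero hζ hD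
  have sq1 : SpecializesTo ζ (1 - RatFunc.X) (1 - ζ) :=
    (SpecializesTo.one ζ).sub (SpecializesTo.X ζ)
  have sy : SpecializesTo ζ (1 - RatFunc.X ^ (2 * N + 1)) 0 :=
    (SpecializesTo.one_sub_X_pow ζ _).of_eq (by rw [(hζ.pow_eq_one_iff_dvd _).2 hN, sub_self])
  have s24 : SpecializesTo ζ (24 : RatFunc ℚ) 24 := by simpa using SpecializesTo.natCast ζ 24
  have sR := (((SpecializesTo.X ζ).pow N).inv (pow_ne_zero _ (hζ.ne_zero (by omega)))).mul
    (sy.add (((((SpecializesTo.natCast ζ (2 * N + 1)).pow 2).sub (SpecializesTo.one ζ)).div s24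
      (by norm_num)).mul (sy.pow 3)))
  rw [← one_sub_X_mul_congruenceRHS] at sR
  rw [← one_sub_X_mul_truncatedSum] at h
  have s := ((h.sub sR).div sq1 hζ1).of_eq (b := 0) (by ring)
  rw [← mul_sub, mul_div_cancel_left₀ _ (sq1.ne_zero hζ1)] at s
  simpa using cyclotomic_pow_dvd_num (Nat.succ_pos _) hζ 0 (b := 1) (by simp) s (by simp)

end ProperDivisors

/-! ### Assembly of the cyclotomic factors. -/

/-- `[n]` is the product of the `Φ_d` with `d ∣ n`, `d ≠ 1`, which are pairwise coprime over `ℚ`;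
its factor `Φ_n` combines with `Φ_n³`. -/
theorem qInteger_mul_cyclotomic_pow_dvd {n : ℕ} (hn : 1 < n) {P : ℚ[X]}
    (h4 : cyclotomic n ℚ ^ 4 ∣ P) (h : ∀ d, d ∣ n → d ≠ 1 → cyclotomic d ℚ ∣ P) :
    qInteger (X : ℚ[X]) n * cyclotomic n ℚ ^ 3 ∣ P := by
  have hmem : n ∈ n.divisors.erase 1 := by simp; omega
  rw [qInteger, ← prod_cyclotomic_eq_geom_sum (by omega) ℚ, ← Finset.mul_prod_erase _ _ hmem,
    mul_right_comm, ← pow_succ']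
  refine IsCoprime.mul_dvd ?_ h4 ?_
  · refine IsCoprime.prod_right fun d hd => IsCoprime.pow_left ?_
    exact cyclotomic.isCoprime_rat (Finset.ne_of_mem_erase hd).symm
  · refine Finset.prod_dvd_of_coprime (fun a _ b _ hab => cyclotomic.isCoprime_rat hab) ?_
    intro d hd
    simp only [Finset.mem_erase, Nat.mem_divisors] at hd
    exact h d hd.2.2.1 hd.2.1

theorem truncatedSum_zero_eq : truncatedSum 0 = congruenceRHS 1 := by
  simp [truncatedSum, congruenceRHS, qShiftedFactorial, qInteger]

theorem mainTheorem6 (n : ℕ) (hn : Odd n) :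
    RatFuncCongr (qInteger (X : ℚ[X]) n * cyclotomic n ℚ ^ 3)
        (truncatedSum ((n - 1) / 2)) (congruenceRHS n) ∧
      RatFuncCongr (qInteger (X : ℚ[X]) n * cyclotomic n ℚ ^ 3)
        (truncatedSum (n - 1)) (congruenceRHS n) := by
  obtain ⟨N, rfl⟩ := hn
  rw [show 2 * N + 1 - 1 = 2 * N by omega, show 2 * N / 2 = N by omega]
  rcases Nat.eq_zero_or_pos N with rfl | hN
  -- For `n = 1` the root of unity is `1` and `1-ζ` is not invertible, but both sides are equal.
  · simp [RatFuncCongr, truncatedSum_zero_eq]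
  have hζ := Complex.isPrimitiveRoot_exp (2 * N + 1) (by omega)
  have hdiv (d : ℕ) (hd : d ∣ 2 * N + 1) (hd1 : d ≠ 1) :
      ∃ D e, 0 < D ∧ d = 2 * D + 1 ∧ 2 * N + 1 = (2 * D + 1) * (2 * e + 1) := by
    obtain ⟨e', he⟩ := hd
    have ho : Odd (d * e') := he ▸ odd_two_mul_add_one N
    obtain ⟨⟨D, hD⟩, ⟨e, he'⟩⟩ := Nat.odd_mul.1 ho
    exact ⟨D, e, by omega, hD, by rw [he, hD, he']⟩
  refine ⟨qInteger_mul_cyclotomic_pow_dvd (by omega) (cyclotomic_pow_four_dvd_num hN hζ) ?_,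
    qInteger_mul_cyclotomic_pow_dvd (by omega) (cyclotomic_pow_four_dvd_num_two_mul hN hζ) ?_⟩
  · intro d hd hd1
    obtain ⟨D, e, hD, rfl, he⟩ := hdiv d hd hd1
    have hζ' := Complex.isPrimitiveRoot_exp (2 * D + 1) (by omega)
    refine cyclotomic_dvd_num_of_specializesTo hD hζ' hd ?_
    -- The short sum consists of `e` full blocks followed by one half block.
    rw [show N + 1 = (2 * D + 1) * e + (D + 1) by linarith]
    exact specializesTo_sum_half hζ' e
  · intro d hd hd1
    obtain ⟨D, e, hD, rfl, he⟩ := hdiv d hd hd1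
    have hζ' := Complex.isPrimitiveRoot_exp (2 * D + 1) (by omega)
    refine cyclotomic_dvd_num_of_specializesTo hD hζ' hd ?_
    rw [he]
    exact specializesTo_sum_full hζ' _
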